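/- Let $\mathcal A$ be a closed bounded subset of a (real, Hausdorff) locally convex space $E$, and let $\overline{\mathrm{co}}\,\mathcal A$ be its convex closure, i.e. the closure of its convex hull. Assume that $\overline{\mathrm{co}}\,\mathcal A$ is a complete separable metric space, in the sense that there is a countable family of continuous seminorms on $E$ which defines the topology of $\overline{\mathrm{co}}\,\mathcal A$, and that $\overline{\mathrm{co}}\,\mathcal A$ is separable and is complete in the metric generated by this family. Let $M(\mathcal A)$ be the set of all Borel probability measures on $\mathcal A$ with the topology of weak convergence. The barycenter $\mathbf b(\mu)\in\overline{\mathrm{co}}\,\mathcal A$ of $\mu\in M(\mathcal A)$ is the Pettis integral $\int_{\mathcal A}x\,\mu(dx)$, i.e. the point with $f(\mathbf b(\mu))=\int_{\mathcal A} f\,d\mu$ for all continuous linear functionals $f$ on $E$. A set $\mathcal A$ as above is called $\mu$-compact if for every compact $K\subseteq\overline{\mathrm{co}}\,\mathcal A$ the preimage $\mathbf b^{-1}(K)=\{\mu\in M(\mathcal A) : \mathbf b(\mu)\in K\}$ is a compact subset of $M(\mathcal A)$. (Thus $\mu$-compactness of a set includes the assumptions on it made above.) **Proposition.** 1. A closed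 subset of a $\mu$-compact set is $\mu$-compact. 2. The convex closure of a $\mu$-compact set is $\mu$-compact. 3. Let $(\mathcal A_i)_{i\in I}$ be a finite or countable family of $\mu$-compact sets $\mathcal A_i\subseteq E_i$, where the $E_i$ are (real, Hausdorff) locally convex spaces. Then the Cartesian product $\prod_{i\in I}\mathcal A_i\subseteq\prod_{i\in I}E_i$ is $\mu$-compact in the topology of coordinatewise convergence. -/

import Mathlib

open Set Filter Topology MeasureTheory

/-- The closed convex hull `closure (co A)` of a set `A`. -/
def convexClosure {E : Type*} [AddCommGroup E] [Module ℝ E] [TopologicalSpace E]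
    (A : Set E) : Set E :=
  closure (convexHull ℝ A)

/-- `C` is a complete separable metric space in the sense of locally convex spaces: there are
countably many continuous seminorms on the whole space which define the topology of `C`, `C` is
separable, and `C` is complete for the metric that these seminorms define. -/
def IsCompleteSeparableMetric {E : Type*} [AddCommGroup E] [Module ℝ E] [TopologicalSpace E]
    (C : Set E) : Prop :=
  TopologicalSpace.SeparableSpace C ∧
  ∃ p : ℕ → Seminorm ℝ E,
    (∀ n, Continuous (p n)) ∧
    -- the relative topology of `C` is the one defined by the `p n`; the other
    -- inclusion of topologies is the continuity of the `p n`
    (∀ x ∈ C, ∀ U ∈ 𝓝 x, ∃ (s : Finset ℕ) (ε : ℝ), 0 < ε ∧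
      ∀ y ∈ C, (∀ n ∈ s, p n (y - x) < ε) → y ∈ U) ∧
    -- every sequence in `C` which is Cauchy for all the `p n` converges in `C`
    (∀ u : ℕ → E, (∀ k, u k ∈ C) →
      (∀ n, ∀ ε : ℝ, 0 < ε → ∃ N, ∀ k ≥ N, ∀ l ≥ N, p n (u k - u l) < ε) →
      ∃ x ∈ C, Tendsto u atTop (𝓝 x))

/-- `x` is the barycenter of the measure `μ` on `A`, that is, the weak (Pettis) integral of the
inclusion of `A` in `E`: `f x = ∫ f dμ` for all continuous linear functionals `f`. -/
def IsBarycenter {E : Type*} [AddCommGroup E] [Module ℝ E] [TopologicalSpace E]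
    {A : Set E} [MeasurableSpace A] (μ : Measure A) (x : E) : Prop :=
  ∀ f : E →L[ℝ] ℝ, Integrable (fun a : A => f a) μ ∧ ∫ a : A, f a ∂μ = f x

/-- In a Hausdorff locally convex space a measure has at most one barycenter. -/
theorem IsBarycenter.unique {E : Type*} [AddCommGroup E] [Module ℝ E] [TopologicalSpace E]
    [IsTopologicalAddGroup E] [ContinuousSMul ℝ E] [LocallyConvexSpace ℝ E] [T2Space E]
    {A : Set E} [MeasurableSpace A] {μ : Measure A} {x y : E}
    (hx : IsBarycenter μ x) (hy : IsBarycenter μ y) : x = y := by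
  by_contra h
  obtain ⟨f, hf⟩ := geometric_hahn_banach_point_point (E := E) h
  exact hf.ne ((hx f).2.symm.trans (hy f).2)

/-- The preimage of `K` under the barycenter map on the space of Borel probability measures
on `A`. -/
def barycenterPreimage {E : Type*} [AddCommGroup E] [Module ℝ E] [TopologicalSpace E]
    (A : Set E) [MeasurableSpace A] (K : Set E) : Set (ProbabilityMeasure A) :=
  {μ | ∃ x ∈ K, IsBarycenter (μ : Measure A) x}

/-- `A` is a closed bounded set whose convex closure is a complete separable metric space, and the
preimage of every compact subset of the convex closure of `A` under the barycenter map is compact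
in the space of Borel probability measures on `A` with the topology of weak convergence. -/
structure IsMuCompact {E : Type*} [AddCommGroup E] [Module ℝ E] [TopologicalSpace E]
    (A : Set E) : Prop where
  isClosed : IsClosed A
  bounded : Bornology.IsVonNBounded ℝ A
  metric : IsCompleteSeparableMetric (convexClosure A)
  isCompact_preimage :
    letI : MeasurableSpace A := borel A
    haveI : BorelSpace A := ⟨rfl⟩
    ∀ K : Set E, K ⊆ convexClosure A → IsCompact K → IsCompact (barycenterPreimage A K)

/-! The preimage of a compact `K` under the barycenter map is always closed, and `A` is Polish, so
by Prokhorov's theorem μ-compactness says that the measures with barycenter in `K` are uniformly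
tight. Pushing measures forward along the inclusion or the coordinate projections gives the closed
subsets and the countable products.

For the convex closure, take compact `Q k ⊆ A` carrying all but a small mass of every measure on `A`
with barycenter in `K`. The points represented by some `ν` with `ν (Q k)ᶜ ≤ r k` for all `k` form a
relatively compact set, since `ν` almost lives on `Q k` and its barycenter is thus close to the hull
of a finite set (`exists_finite_net_barycenter`). It remains to see that each `μ` on the convex
closure with barycenter `x₀ ∈ K` gives little mass to the other points. By μ-compactness the
envelope `x ↦ sup ∫ φ dν` over the `ν` representing `x` has a closed convex hypograph. Hahn-Banach
then bounds it by a continuous affine function with nearly the same value at `x₀`. The `μ`-integral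
of that function is its value at `x₀`, and Markov's inequality concludes
(`IsMuCompact.measure_compl_gt_le`). -/

open scoped Uniformity

/-! ### Complete separable sets as Polish spaces -/

section CompleteSeparable

variable {E : Type*} [AddCommGroup E] [Module ℝ E]

/-- The uniform structure on a set defined by a sequence of seminorms on the whole space. -/
@[reducible] def seminormUniformSpace (p : ℕ → Seminorm ℝ E) (C : Set E) : UniformSpace C :=
  ⨅ n, (@PseudoMetricSpace.toUniformSpace C (PseudoMetricSpace.induced Subtype.val
    (p n).toAddGroupSeminorm.toSeminormedAddCommGroup.toPseudoMetricSpace))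

theorem hasBasis_uniformity_seminorm (q : Seminorm ℝ E) (C : Set E) :
    (@uniformity C (@PseudoMetricSpace.toUniformSpace C (PseudoMetricSpace.induced Subtype.val
      q.toAddGroupSeminorm.toSeminormedAddCommGroup.toPseudoMetricSpace))).HasBasis
      (fun ε : ℝ => 0 < ε) fun ε => {z : C × C | q (z.1 - z.2 : E) < ε} := by
  let : PseudoMetricSpace C := PseudoMetricSpace.induced Subtype.val
    q.toAddGroupSeminorm.toSeminormedAddCommGroup.toPseudoMetricSpace
  have h := Metric.uniformity_basis_dist (α := C)
  have e (x y : C) : dist x y = q (x - y : E) := by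
    change q (-(x : E) + y) = q (x - y : E)
    rw [← map_neg_eq_map]; congr 1; abel
  simpa only [e] using h

theorem uniformity_seminormUniformSpace (p : ℕ → Seminorm ℝ E) (C : Set E) :
    @uniformity C (seminormUniformSpace p C) = ⨅ n,
      (@uniformity C (@PseudoMetricSpace.toUniformSpace C (PseudoMetricSpace.induced Subtype.val
      (p n).toAddGroupSeminorm.toSeminormedAddCommGroup.toPseudoMetricSpace))) :=
  iInf_uniformity

theorem isCountablyGenerated_seminormUniformSpace (p : ℕ → Seminorm ℝ E) (C : Set E) :
    (@uniformity C (seminormUniformSpace p C)).IsCountablyGenerated := by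
  rw [uniformity_seminormUniformSpace]
  have (n : ℕ) : (@uniformity C (@PseudoMetricSpace.toUniformSpace C
      (PseudoMetricSpace.induced Subtype.val
        (p n).toAddGroupSeminorm.toSeminormedAddCommGroup.toPseudoMetricSpace))).IsCountablyGenerated := by
    let : PseudoMetricSpace C := PseudoMetricSpace.induced Subtype.val
      (p n).toAddGroupSeminorm.toSeminormedAddCommGroup.toPseudoMetricSpace
    exact (inferInstance : (𝓤 C).IsCountablyGenerated)
  exact Filter.iInf.isCountablyGenerated _

theorem seminorm_lt_mem_uniformity (p : ℕ → Seminorm ℝ E) (C : Set E) (n : ℕ) {ε : ℝ}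
    (hε : 0 < ε) :
    {z : C × C | p n (z.1 - z.2 : E) < ε} ∈ @uniformity C (seminormUniformSpace p C) := by
  rw [uniformity_seminormUniformSpace]
  exact mem_iInf_of_mem n ((hasBasis_uniformity_seminorm (p n) C).mem_of_mem hε)

variable [TopologicalSpace E] [IsTopologicalAddGroup E]

theorem toTopologicalSpace_seminormUniformSpace {p : ℕ → Seminorm ℝ E} {C : Set E}
    (hp : ∀ n, Continuous (p n))
    (htop : ∀ x ∈ C, ∀ U ∈ 𝓝 x, ∃ (s : Finset ℕ) (ε : ℝ), 0 < ε ∧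
      ∀ y ∈ C, (∀ n ∈ s, p n (y - x) < ε) → y ∈ U) :
    (seminormUniformSpace p C).toTopologicalSpace = instTopologicalSpaceSubtype := by
  refine TopologicalSpace.ext_nhds fun x => le_antisymm ?_ ?_
  · intro U hU
    rw [nhds_subtype_eq_comap] at hU
    obtain ⟨V, hV, hVU⟩ := hU
    obtain ⟨s, ε, hε, h⟩ := htop x x.2 V hV
    rw [@UniformSpace.mem_nhds_iff C (seminormUniformSpace p C)]
    refine ⟨⋂ n ∈ s, {z : C × C | p n (z.1 - z.2 : E) < ε},
      (Filter.biInter_finset_mem s).2 fun n _ => seminorm_lt_mem_uniformity p C n hε, ?_⟩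
    intro y hy
    refine hVU (h y y.2 fun n hn => ?_)
    have : p n (x - y : E) < ε := by
      have := mem_iInter₂.1 hy n hn
      exact this
    rwa [← map_neg_eq_map, neg_sub]
  · rw [@nhds_eq_comap_uniformity C (seminormUniformSpace p C), uniformity_seminormUniformSpace,
      comap_iInf]
    refine le_iInf fun n => ?_
    refine ((hasBasis_uniformity_seminorm (p n) C).comap _).ge_iff.2 fun ε hε => ?_
    have hc : Continuous fun y : C => p n ((x : E) - y) := by fun_prop
    have : Tendsto (fun y : C => p n ((x : E) - y)) (𝓝 x) (𝓝 0) := by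
      simpa using hc.tendsto x
    exact this (Iio_mem_nhds hε)

theorem completeSpace_seminormUniformSpace {p : ℕ → Seminorm ℝ E} {C : Set E}
    (hp : ∀ n, Continuous (p n))
    (htop : ∀ x ∈ C, ∀ U ∈ 𝓝 x, ∃ (s : Finset ℕ) (ε : ℝ), 0 < ε ∧
      ∀ y ∈ C, (∀ n ∈ s, p n (y - x) < ε) → y ∈ U)
    (hcomp : ∀ u : ℕ → E, (∀ k, u k ∈ C) →
      (∀ n, ∀ ε : ℝ, 0 < ε → ∃ N, ∀ k ≥ N, ∀ l ≥ N, p n (u k - u l) < ε) →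
      ∃ x ∈ C, Tendsto u atTop (𝓝 x)) :
    @CompleteSpace C (seminormUniformSpace p C) := by
  have := isCountablyGenerated_seminormUniformSpace p C
  refine @UniformSpace.complete_of_cauchySeq_tendsto C (seminormUniformSpace p C) this
    fun u hu => ?_
  obtain ⟨x, hx, hux⟩ := hcomp (fun k => u k) (fun k => (u k).2) fun n ε hε => by
    obtain ⟨N, hN⟩ := (@cauchySeq_iff C (seminormUniformSpace p C) u).1 hu _
      (seminorm_lt_mem_uniformity p C n hε)
    exact ⟨N, fun k hk l hl => hN k hk l hl⟩
  refine ⟨⟨x, hx⟩, ?_⟩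
  rw [toTopologicalSpace_seminormUniformSpace hp htop]
  exact tendsto_subtype_rng.2 hux

theorem IsCompleteSeparableMetric.polishSpace [T2Space E] {C : Set E}
    (h : IsCompleteSeparableMetric C) : PolishSpace C := by
  obtain ⟨hsep, p, hp, htop, hcomp⟩ := h
  -- Replacing the topology makes the one underlying this uniformity definitionally the subspace
  -- topology.
  let : UniformSpace C := (seminormUniformSpace p C).replaceTopology
    (toTopologicalSpace_seminormUniformSpace hp htop).symm
  have e : (this : UniformSpace C) = seminormUniformSpace p C := UniformSpace.replaceTopology_eq _ _
  have : CompleteSpace C := by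
    rw [e]; exact completeSpace_seminormUniformSpace hp htop hcomp
  have : (𝓤 C).IsCountablyGenerated := by
    rw [e]; exact isCountablyGenerated_seminormUniformSpace p C
  infer_instance

/-- A subset of a complete separable metric set with finite nets for each of the defining
seminorms is relatively compact. -/
theorem exists_isCompact_of_finite_nets {p : ℕ → Seminorm ℝ E} {C : Set E}
    (hp : ∀ n, Continuous (p n))
    (htop : ∀ x ∈ C, ∀ U ∈ 𝓝 x, ∃ (s : Finset ℕ) (ε : ℝ), 0 < ε ∧
      ∀ y ∈ C, (∀ n ∈ s, p n (y - x) < ε) → y ∈ U)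
    (hcomp : ∀ u : ℕ → E, (∀ k, u k ∈ C) →
      (∀ n, ∀ ε : ℝ, 0 < ε → ∃ N, ∀ k ≥ N, ∀ l ≥ N, p n (u k - u l) < ε) →
      ∃ x ∈ C, Tendsto u atTop (𝓝 x))
    {L : Set E}
    (hnet : ∀ n, ∀ ε : ℝ, 0 < ε → ∃ F : Set E, F.Finite ∧ ∀ x ∈ L, ∃ y ∈ F, p n (x - y) < ε) :
    ∃ K : Set C, IsCompact K ∧ Subtype.val ⁻¹' L ⊆ K := by
  let : UniformSpace C := (seminormUniformSpace p C).replaceTopology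
    (toTopologicalSpace_seminormUniformSpace hp htop).symm
  have e : (this : UniformSpace C) = seminormUniformSpace p C := UniformSpace.replaceTopology_eq _ _
  have : CompleteSpace C := by
    rw [e]; exact completeSpace_seminormUniformSpace hp htop hcomp
  refine ⟨closure (Subtype.val ⁻¹' L), TotallyBounded.isCompact_of_isClosed
    (TotallyBounded.closure ?_) isClosed_closure, subset_closure⟩
  -- An ultrafilter containing a finite union of balls contains one of them, so the Cauchy property
  -- can be checked one seminorm at a time.
  rw [totallyBounded_iff_ultrafilter]
  intro f hf
  refine ⟨inferInstance, ?_⟩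
  have e' : 𝓤 C = @uniformity C (seminormUniformSpace p C) := by rw [e]
  rw [e', uniformity_seminormUniformSpace]
  refine le_iInf fun n => ?_
  refine (hasBasis_uniformity_seminorm (p n) C).ge_iff.2 fun ε hε => ?_
  obtain ⟨F, hF, hLF⟩ := hnet n (ε / 2) (half_pos hε)
  have hmem : (⋃ y ∈ F, {x : C | p n (x - y : E) < ε / 2}) ∈ f := by
    refine mem_of_superset (le_principal_iff.1 hf) fun x hx => ?_
    obtain ⟨y, hy, hxy⟩ := hLF x hx
    exact mem_biUnion hy hxy
  obtain ⟨y, -, hy⟩ := (Ultrafilter.finite_biUnion_mem_iff hF).1 hmem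
  refine mem_prod_iff.2 ⟨_, hy, _, hy, ?_⟩
  rintro ⟨a, b⟩ ⟨ha, hb⟩
  have ha : p n (a - y : E) < ε / 2 := ha
  have hb : p n (b - y : E) < ε / 2 := hb
  change p n (a - b : E) < ε
  calc p n (a - b : E) = p n ((a - y : E) - (b - y)) := by congr 1; abel
    _ ≤ p n (a - y : E) + p n (b - y : E) := map_sub_le_add _ _ _
    _ < ε := by linarith

theorem IsCompleteSeparableMetric.mono [T2Space E] {C D : Set E}
    (h : IsCompleteSeparableMetric C) (hDC : D ⊆ C) (hD : IsClosed D) :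
    IsCompleteSeparableMetric D := by
  have := h.polishSpace
  obtain ⟨-, p, hp, htop, hcomp⟩ := h
  refine ⟨?_, p, hp, fun x hx U hU => ?_, fun u hu hcau => ?_⟩
  -- Separability need not pass to subsets; second countability does.
  · have := (Topology.IsEmbedding.inclusion hDC).secondCountableTopology
    infer_instance
  · obtain ⟨s, ε, hε, h⟩ := htop x (hDC hx) U hU
    exact ⟨s, ε, hε, fun y hy => h y (hDC hy)⟩
  · obtain ⟨x, -, hx⟩ := hcomp u (fun k => hDC (hu k)) hcau
    exact ⟨x, hD.mem_of_tendsto hx (Eventually.of_forall hu), hx⟩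

end CompleteSeparable

theorem IsCompleteSeparableMetric.pi {ι : Type*} [Countable ι] {E : ι → Type*}
    [∀ i, AddCommGroup (E i)] [∀ i, Module ℝ (E i)] [∀ i, TopologicalSpace (E i)]
    {C : ∀ i, Set (E i)} (h : ∀ i, IsCompleteSeparableMetric (C i)) :
    IsCompleteSeparableMetric (Set.pi univ C) := by
  have hsep (i) := (h i).1
  choose p hp htop hcomp using fun i => (h i).2
  let := Encodable.ofCountable (ι × ℕ)
  -- The pairs (coordinate, seminorm) are enumerated by `ℕ`; numbers that code no pair get the zero
  -- seminorm.
  let q (n : ℕ) : Seminorm ℝ (∀ i, E i) :=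
    (Encodable.decode (α := ι × ℕ) n).elim 0 fun z => (p z.1 z.2).comp (LinearMap.proj z.1)
  have hq (i : ι) (m : ℕ) (x : ∀ i, E i) : q (Encodable.encode (i, m)) x = p i m (x i) := by
    simp [q]
  refine ⟨?_, q, fun n => ?_, fun x hx U hU => ?_, fun u hu hcau => ?_⟩
  · let g : (∀ i, C i) → Set.pi univ C := fun z => ⟨fun i => z i, fun i _ => (z i).2⟩
    have hg : Function.Surjective g := fun x => ⟨fun i => ⟨x.1 i, x.2 i trivial⟩, rfl⟩
    exact hg.denseRange.separableSpace (by fun_prop)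
  · rcases hd : Encodable.decode (α := ι × ℕ) n with _ | z
    · simp only [q, hd]; exact continuous_const
    · simp only [q, hd]
      exact (hp z.1 z.2).comp (continuous_apply z.1)
  · rw [nhds_pi, Filter.mem_pi] at hU
    obtain ⟨I, hI, t, ht, hIt⟩ := hU
    choose s ε hε hs using fun i => htop i (x i) (hx i trivial) (t i) (ht i)
    classical
    obtain ⟨δ, hδ, hδε⟩ : ∃ δ > 0, ∀ i ∈ I, δ ≤ ε i := by
      have h : ∀ᶠ δ in 𝓝[>] (0 : ℝ), ∀ i ∈ I, δ < ε i :=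
        (eventually_all_finite hI).2 fun i _ => nhdsWithin_le_nhds (Iio_mem_nhds (hε i))
      obtain ⟨δ, hδ, h0⟩ := (h.and self_mem_nhdsWithin).exists
      exact ⟨δ, h0, fun i hi => (hδ i hi).le⟩
    refine ⟨hI.toFinset.biUnion fun i => (s i).image fun m => Encodable.encode (i, m), δ, hδ,
      fun y hy hyx => hIt fun i hi => hs i (y i) (hy i trivial) fun m hm => ?_⟩
    have := hyx (Encodable.encode (i, m)) (Finset.mem_biUnion.2
      ⟨i, hI.mem_toFinset.2 hi, Finset.mem_image_of_mem _ hm⟩)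
    rw [hq] at this
    exact this.trans_le (hδε i hi)
  · have (i : ι) : ∃ x ∈ C i, Tendsto (fun k => u k i) atTop (𝓝 x) := by
      refine hcomp i (fun k => u k i) (fun k => hu k i trivial) fun n ε hε => ?_
      obtain ⟨N, hN⟩ := hcau (Encodable.encode (i, n)) ε hε
      exact ⟨N, fun k hk l hl => by simpa [hq] using hN k hk l hl⟩
    choose x hx hux using this
    exact ⟨x, fun i _ => hx i, tendsto_pi_nhds.2 hux⟩

/-! ### Barycenters, weak limits and tightness -/

section Barycenter

variable {E : Type*} [AddCommGroup E] [Module ℝ E] [TopologicalSpace E]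

theorem Bornology.IsVonNBounded.exists_seminorm_le {A : Set E}
    (hA : Bornology.IsVonNBounded ℝ A) {q : Seminorm ℝ E} (hq : Continuous q) :
    ∃ M > 0, ∀ a ∈ A, q a ≤ M := by
  have hV : {y | q y < 1} ∈ 𝓝 (0 : E) :=
    hq.continuousAt.eventually_lt_const (by simp)
  obtain ⟨r, hr, h⟩ := (hA hV).exists_pos
  refine ⟨r, hr, fun a ha => ?_⟩
  obtain ⟨y, hy, rfl⟩ := h r (by simp [abs_of_pos hr]) ha
  have hy : q y < 1 := hy
  simp only [map_smul_eq_mul, Real.norm_eq_abs, abs_of_pos hr]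
  nlinarith

theorem exists_boundedContinuousFunction_eq {A : Set E} (hA : Bornology.IsVonNBounded ℝ A)
    (f : E →L[ℝ] ℝ) : ∃ g : BoundedContinuousFunction A ℝ, ∀ a, g a = f a := by
  obtain ⟨M, -, hM⟩ := hA.exists_seminorm_le (q := (normSeminorm ℝ ℝ).comp f.toLinearMap)
    (continuous_norm.comp f.continuous)
  exact ⟨BoundedContinuousFunction.ofNormedAddCommGroup (fun a : A => f a)
    (by fun_prop) M fun a => hM a a.2, fun _ => rfl⟩

variable {A : Set E} [MeasurableSpace A] [BorelSpace A]

theorem integrable_continuousLinearMap (hA : Bornology.IsVonNBounded ℝ A) (μ : Measure A)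
    [IsFiniteMeasure μ] (f : E →L[ℝ] ℝ) : Integrable (fun a : A => f a) μ := by
  obtain ⟨g, hg⟩ := exists_boundedContinuousFunction_eq hA f
  exact (g.integrable μ).congr (ae_of_all _ hg)

/-- As `A` is bounded, continuous linear functionals restrict to bounded continuous functions on it,
which weak convergence tests. -/
theorem isBarycenter_of_tendsto (hA : Bornology.IsVonNBounded ℝ A) {κ : Type*} {l : Filter κ}
    [l.NeBot] {ν : κ → ProbabilityMeasure A} {ν₀ : ProbabilityMeasure A} {x : κ → E} {x₀ : E}
    (hν : Tendsto ν l (𝓝 ν₀)) (hx : Tendsto x l (𝓝 x₀))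
    (h : ∀ᶠ k in l, IsBarycenter (ν k : Measure A) (x k)) :
    IsBarycenter (ν₀ : Measure A) x₀ := by
  intro f
  refine ⟨integrable_continuousLinearMap hA _ f, ?_⟩
  obtain ⟨g, hg⟩ := exists_boundedContinuousFunction_eq hA f
  have h₁ := ProbabilityMeasure.tendsto_iff_forall_integral_tendsto.1 hν g
  simp only [hg] at h₁
  refine tendsto_nhds_unique (h₁.congr' ?_) ((f.continuous.tendsto x₀).comp hx)
  filter_upwards [h] with k hk using (hk f).2

/-- Continuity of the barycenter map is not needed: along an ultrafilter the barycenters converge by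
compactness of `K`, and the limit is the barycenter of the limit measure. -/
theorem isClosed_barycenterPreimage (hA : Bornology.IsVonNBounded ℝ A) {K : Set E}
    (hK : IsCompact K) : IsClosed (barycenterPreimage A K) := by
  rw [isClosed_iff_ultrafilter]
  intro ν₀ U hU hmem
  have hb : ∀ ν : ProbabilityMeasure A, ∃ x : E, ν ∈ barycenterPreimage A K →
      x ∈ K ∧ IsBarycenter (ν : Measure A) x := fun ν => by
    by_cases h : ν ∈ barycenterPreimage A K
    · obtain ⟨x, hx⟩ := h
      exact ⟨x, fun _ => hx⟩
    · exact ⟨0, fun h' => absurd h' h⟩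
  choose b hb using hb
  obtain ⟨x, hxK, hx⟩ := hK.ultrafilter_le_nhds (U.map b)
    (le_principal_iff.2 (show b ⁻¹' K ∈ U from mem_of_superset hmem fun ν hν => (hb ν hν).1))
  have hx : Tendsto b U (𝓝 x) := hx
  exact ⟨x, hxK, isBarycenter_of_tendsto hA (l := (U : Filter _)) (ν := id) (x := b) (tendsto_id'.2 hU) hx
    (mem_of_superset hmem fun ν hν => (hb ν hν).2)⟩

theorem isCompact_barycenterPreimage_of_tight [T2Space E] (hA : Bornology.IsVonNBounded ℝ A)
    {K : Set E} (hK : IsCompact K)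
    (h : ∀ ε : ENNReal, 0 < ε → ∃ Q : Set A, IsCompact Q ∧ ∀ ν : ProbabilityMeasure A, ∀ x ∈ K,
      IsBarycenter (ν : Measure A) x → (ν : Measure A) Qᶜ ≤ ε) :
    IsCompact (barycenterPreimage A K) := by
  rw [← (isClosed_barycenterPreimage hA hK).closure_eq]
  refine isCompact_closure_of_isTightMeasureSet
    (isTightMeasureSet_iff_exists_isCompact_measure_compl_le.2 fun ε hε => ?_)
  obtain ⟨Q, hQ, h⟩ := h ε hε
  refine ⟨Q, hQ, ?_⟩
  rintro _ ⟨ν, ⟨x, hx, hb⟩, rfl⟩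
  exact h ν x hx hb

theorem tight_of_isCompact_barycenterPreimage [PolishSpace A] {K : Set E}
    (h : IsCompact (barycenterPreimage A K)) {ε : ENNReal} (hε : 0 < ε) :
    ∃ Q : Set A, IsCompact Q ∧ ∀ ν : ProbabilityMeasure A, ∀ x ∈ K,
      IsBarycenter (ν : Measure A) x → (ν : Measure A) Qᶜ ≤ ε := by
  let := TopologicalSpace.upgradeIsCompletelyMetrizable A
  obtain ⟨Q, hQ, hν⟩ := isTightMeasureSet_iff_exists_isCompact_measure_compl_le.1
    (isTightMeasureSet_of_isCompact_closure (S := barycenterPreimage A K) h.closure) ε hε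
  exact ⟨Q, hQ, fun ν x hx hb => hν _ ⟨ν, ⟨x, hx, hb⟩, rfl⟩⟩

theorem IsBarycenter.map {F : Type*} [AddCommGroup F] [Module ℝ F] [TopologicalSpace F]
    {B : Set F} [MeasurableSpace B] [BorelSpace B] (hB : Bornology.IsVonNBounded ℝ B)
    {μ : Measure A} [IsProbabilityMeasure μ] {x : E} (h : IsBarycenter μ x) (T : E →L[ℝ] F)
    {g : A → B} (hg : Continuous g) (hgT : ∀ a, (g a : F) = T a) :
    IsBarycenter (μ.map g) (T x) := by
  have hm : AEMeasurable g μ := hg.measurable.aemeasurable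
  have := Measure.isProbabilityMeasure_map hm
  intro f
  refine ⟨integrable_continuousLinearMap hB _ f, ?_⟩
  have hf : AEStronglyMeasurable (fun b : B => f b) (μ.map g) :=
    (integrable_continuousLinearMap hB _ f).aestronglyMeasurable
  rw [integral_map hm hf]
  simp only [hgT]
  exact (h (f.comp T)).2

end Barycenter

/-! ### Convex closures -/

section ConvexClosure

variable {E : Type*} [AddCommGroup E] [Module ℝ E] [TopologicalSpace E]
  [IsTopologicalAddGroup E] [ContinuousSMul ℝ E] [LocallyConvexSpace ℝ E]
  {A : Set E} [MeasurableSpace A]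

theorem IsBarycenter.mem_of_subset {μ : Measure A} [IsProbabilityMeasure μ] {x : E}
    (h : IsBarycenter μ x) {C : Set E} (hAC : A ⊆ C) (hC : IsClosed C) (hconv : Convex ℝ C) :
    x ∈ C := by
  by_contra hx
  obtain ⟨f, u, hf, hu⟩ := geometric_hahn_banach_closed_point hconv hC hx
  obtain ⟨hi, he⟩ := h f
  have := integral_mono hi (integrable_const u) fun a : A => (hf a (hAC a.2)).le
  simp only [integral_const, probReal_univ, one_smul] at this
  linarith

end ConvexClosure

section ConvexClosure

variable {E : Type*} [AddCommGroup E] [Module ℝ E] [TopologicalSpace E]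

theorem isClosed_convexClosure (A : Set E) : IsClosed (convexClosure A) := isClosed_closure

theorem subset_convexClosure (A : Set E) : A ⊆ convexClosure A :=
  (subset_convexHull ℝ A).trans subset_closure

theorem convexClosure_subset {A C : Set E} (h : A ⊆ C) (hC : IsClosed C) (hconv : Convex ℝ C) :
    convexClosure A ⊆ C :=
  closure_minimal (convexHull_min h hconv) hC

variable [IsTopologicalAddGroup E] [ContinuousSMul ℝ E]

theorem convex_convexClosure (A : Set E) : Convex ℝ (convexClosure A) :=
  (convex_convexHull ℝ A).closure

theorem convexClosure_mono {A B : Set E} (h : A ⊆ B) : convexClosure A ⊆ convexClosure B :=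
  convexClosure_subset (h.trans (subset_convexClosure B)) (isClosed_convexClosure B)
    (convex_convexClosure B)

theorem convexClosure_convexClosure (A : Set E) :
    convexClosure (convexClosure A) = convexClosure A :=
  (convexClosure_subset Subset.rfl (isClosed_convexClosure A) (convex_convexClosure A)).antisymm
    (subset_convexClosure _)

theorem Bornology.IsVonNBounded.convexClosure [LocallyConvexSpace ℝ E] [T2Space E] {A : Set E}
    (hA : Bornology.IsVonNBounded ℝ A) : Bornology.IsVonNBounded ℝ (convexClosure A) := by
  refine Bornology.IsVonNBounded.closure fun V hV => ?_
  obtain ⟨W, hW, hconv, hWV⟩ :=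
    (locallyConvexSpace_iff_exists_convex_subset_zero ℝ E).1 ‹_› V hV
  exact Filter.Eventually.mono (hA hW) fun c hc => (convexHull_min hc (hconv.smul c)).trans (smul_set_mono hWV)

end ConvexClosure

/-! ### μ-compactness as uniform tightness; closed subsets -/

section MuCompact

variable {E : Type*} [AddCommGroup E] [Module ℝ E] [TopologicalSpace E]

theorem IsMuCompact.of_tight [T2Space E] {A : Set E} (hcl : IsClosed A) (hA : Bornology.IsVonNBounded ℝ A)
    (hm : IsCompleteSeparableMetric (convexClosure A))
    (h : ∀ [MeasurableSpace A] [BorelSpace A], ∀ K : Set E, K ⊆ convexClosure A → IsCompact K →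
      ∀ ε : ENNReal, 0 < ε → ∃ Q : Set A, IsCompact Q ∧ ∀ ν : ProbabilityMeasure A, ∀ x ∈ K,
      IsBarycenter (ν : Measure A) x → (ν : Measure A) Qᶜ ≤ ε) : IsMuCompact A where
  isClosed := hcl
  bounded := hA
  metric := hm
  isCompact_preimage := by
    let : MeasurableSpace A := borel A
    have : BorelSpace A := ⟨rfl⟩
    exact fun K hK hKc => isCompact_barycenterPreimage_of_tight hA hKc (h K hK hKc)

theorem IsMuCompact.isCompact_barycenterPreimage {A : Set E} (h : IsMuCompact A)
    [MeasurableSpace A] [hB : BorelSpace A] {K : Set E} (hK : K ⊆ convexClosure A)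
    (hKc : IsCompact K) : IsCompact (barycenterPreimage A K) := by
  obtain rfl := hB.measurable_eq
  exact h.isCompact_preimage K hK hKc

variable [IsTopologicalAddGroup E] [T2Space E]

theorem IsMuCompact.polishSpace {A : Set E} (h : IsMuCompact A) : PolishSpace A :=
  (h.metric.mono (subset_convexClosure A) h.isClosed).polishSpace

theorem IsMuCompact.tight {A : Set E} (h : IsMuCompact A)
    [MeasurableSpace A] [BorelSpace A] {K : Set E} (hK : K ⊆ convexClosure A)
    (hKc : IsCompact K) {ε : ENNReal} (hε : 0 < ε) :
    ∃ Q : Set A, IsCompact Q ∧ ∀ ν : ProbabilityMeasure A, ∀ x ∈ K,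
      IsBarycenter (ν : Measure A) x → (ν : Measure A) Qᶜ ≤ ε :=
  have := h.polishSpace
  tight_of_isCompact_barycenterPreimage (h.isCompact_barycenterPreimage hK hKc) hε

variable [ContinuousSMul ℝ E]

theorem IsMuCompact.subset {A B : Set E} (h : IsMuCompact A) (hBA : B ⊆ A) (hB : IsClosed B) :
    IsMuCompact B := by
  refine .of_tight hB (h.bounded.subset hBA)
    (h.metric.mono (convexClosure_mono hBA) (isClosed_convexClosure B)) ?_
  intro _ _ K hK hKc ε hε
  let : MeasurableSpace A := borel A
  have : BorelSpace A := ⟨rfl⟩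
  obtain ⟨Q, hQ, hν⟩ := h.tight (hK.trans (convexClosure_mono hBA)) hKc hε
  have hj : IsClosedEmbedding (inclusion hBA) :=
    ⟨Topology.IsEmbedding.inclusion hBA, by
      rw [range_inclusion]; exact hB.preimage continuous_subtype_val⟩
  refine ⟨inclusion hBA ⁻¹' Q, hj.isCompact_preimage hQ, fun ν x hx hb => ?_⟩
  have hm : AEMeasurable (inclusion hBA) (ν : Measure B) := hj.continuous.measurable.aemeasurable
  have := hν (ν.map hm) x hx
    (hb.map h.bounded (ContinuousLinearMap.id ℝ E) hj.continuous fun _ => rfl)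
  rwa [ProbabilityMeasure.map_apply' _ _ hQ.measurableSet.compl] at this

end MuCompact

/-! ### Countable products -/

theorem IsMuCompact.pi {ι : Type*} [Countable ι] {E : ι → Type*} [∀ i, AddCommGroup (E i)]
    [∀ i, Module ℝ (E i)] [∀ i, TopologicalSpace (E i)] [∀ i, IsTopologicalAddGroup (E i)]
    [∀ i, ContinuousSMul ℝ (E i)] [∀ i, LocallyConvexSpace ℝ (E i)] [∀ i, T2Space (E i)]
    {A : ∀ i, Set (E i)} (h : ∀ i, IsMuCompact (A i)) : IsMuCompact (Set.pi univ A) := by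
  have hsub : convexClosure (Set.pi univ A) ⊆ Set.pi univ fun i => convexClosure (A i) :=
    convexClosure_subset (pi_mono fun i _ => subset_convexClosure (A i))
      (isClosed_set_pi fun i _ => isClosed_convexClosure (A i))
      (convex_pi fun i _ => convex_convexClosure (A i))
  have hcl : IsClosed (Set.pi univ A) := isClosed_set_pi fun i _ => (h i).isClosed
  have hbd : Bornology.IsVonNBounded ℝ (Set.pi univ A) :=
    Bornology.isVonNBounded_pi_iff.2 fun i => (h i).bounded.subset (by
      rintro _ ⟨x, hx, rfl⟩; exact hx i trivial)
  refine .of_tight hcl hbd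
    ((IsCompleteSeparableMetric.pi fun i => (h i).metric).mono hsub (isClosed_convexClosure _)) ?_
  intro _ _ K hK hKc ε hε
  -- The `i`-th marginal may lose mass `δ i` outside `Q i`; the total loss is below `ε`.
  obtain ⟨δ, hδ, hδε⟩ := ENNReal.exists_pos_sum_of_countable' hε.ne' ι
  let (i : ι) : MeasurableSpace (A i) := borel (A i)
  have (i : ι) : BorelSpace (A i) := ⟨rfl⟩
  let π (i : ι) (x : Set.pi univ A) : A i := ⟨x.1 i, x.2 i trivial⟩
  have hπ (i : ι) : Continuous (π i) :=
    ((continuous_apply i).comp continuous_subtype_val).subtype_mk _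
  choose Q hQ hν using fun i => (h i).tight (K := (fun x => x i) '' K)
    (by rintro _ ⟨x, hx, rfl⟩; exact hsub (hK hx) i trivial)
    (hKc.image (continuous_apply i)) (hδ i)
  have hQc : IsCompact (⋂ i, π i ⁻¹' Q i) := by
    have : IsCompact (Set.pi univ fun i => ((↑) : A i → E i) '' Q i) :=
      isCompact_univ_pi fun i => (hQ i).image continuous_subtype_val
    refine (hcl.isClosedEmbedding_subtypeVal.isCompact_preimage this).of_isClosed_subset
      (isClosed_iInter fun i => (hQ i).isClosed.preimage (hπ i)) fun x hx i _ => ?_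
    exact ⟨π i x, mem_iInter.1 hx i, rfl⟩
  refine ⟨_, hQc, fun ν x hx hb => ?_⟩
  rw [compl_iInter]
  refine (measure_iUnion_le _).trans ((ENNReal.tsum_le_tsum fun i => ?_).trans hδε.le)
  have hm : AEMeasurable (π i) (ν : Measure (Set.pi univ A)) := (hπ i).measurable.aemeasurable
  have := hν i (ν.map hm) (x i) (mem_image_of_mem _ hx)
    (hb.map (h i).bounded (ContinuousLinearMap.proj i) (hπ i) fun _ => rfl)
  rwa [ProbabilityMeasure.map_apply' _ _ (hQ i).measurableSet.compl] at this

/-! ### The upper envelope over representing measures -/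

theorem exists_probabilityMeasure_convex_combination {X : Type*} [MeasurableSpace X]
    (μ ν : ProbabilityMeasure X) {a b : ℝ} (ha : 0 ≤ a) (hb : 0 ≤ b) (hab : a + b = 1) :
    ∃ m : ProbabilityMeasure X, ∀ g : X → ℝ, Integrable g (μ : Measure X) →
      Integrable g (ν : Measure X) → Integrable g (m : Measure X) ∧
        ∫ x, g x ∂(m : Measure X) =
          a * ∫ x, g x ∂(μ : Measure X) + b * ∫ x, g x ∂(ν : Measure X) := by
  have : IsProbabilityMeasure
      (ENNReal.ofReal a • (μ : Measure X) + ENNReal.ofReal b • (ν : Measure X)) :=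
    ⟨by simp [← ENNReal.ofReal_add ha hb, hab]⟩
  refine ⟨⟨_, this⟩, fun g hμ hν => ?_⟩
  have h₁ := hμ.smul_measure (ENNReal.ofReal_ne_top (r := a))
  have h₂ := hν.smul_measure (ENNReal.ofReal_ne_top (r := b))
  refine ⟨h₁.add_measure h₂, ?_⟩
  simp only [ProbabilityMeasure.coe_mk]
  rw [integral_add_measure h₁ h₂, integral_smul_measure, integral_smul_measure,
    ENNReal.toReal_ofReal ha, ENNReal.toReal_ofReal hb, smul_eq_mul, smul_eq_mul]

section Hypograph

variable {E : Type*} [AddCommGroup E] [Module ℝ E] [TopologicalSpace E]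
  {A : Set E} [MeasurableSpace A]

/-- The hypograph of the function which sends `x` to the supremum of `∫ φ dν` over the
probability measures `ν` with barycenter `x`. -/
def barycenterHypograph (φ : BoundedContinuousFunction A ℝ) : Set (E × ℝ) :=
  {z | ∃ ν : ProbabilityMeasure A, IsBarycenter (ν : Measure A) z.1 ∧
    z.2 ≤ ∫ a, φ a ∂(ν : Measure A)}

variable [BorelSpace A]

theorem convex_barycenterHypograph (φ : BoundedContinuousFunction A ℝ) :
    Convex ℝ (barycenterHypograph φ) := by
  rintro z ⟨ν, hν, hz⟩ w ⟨ν', hν', hw⟩ a b ha hb hab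
  obtain ⟨m, hm⟩ := exists_probabilityMeasure_convex_combination ν ν' ha hb hab
  refine ⟨m, fun f => ?_, ?_⟩
  · obtain ⟨h₁, h₂⟩ := hm _ (hν f).1 (hν' f).1
    exact ⟨h₁, by simp [h₂, (hν f).2, (hν' f).2]⟩
  · rw [(hm φ (φ.integrable _) (φ.integrable _)).2]
    simp only [Prod.snd_add, Prod.smul_snd, smul_eq_mul]
    gcongr

/-- The hypograph lies over the metrizable convex closure, so sequences suffice. A convergent
sequence of barycenters together with its limit is compact, hence by μ-compactness the representing
measures have a limit along an ultrafilter. -/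
theorem IsMuCompact.isClosed_barycenterHypograph [IsTopologicalAddGroup E] [ContinuousSMul ℝ E]
    [LocallyConvexSpace ℝ E] [T2Space E] (h : IsMuCompact A)
    (φ : BoundedContinuousFunction A ℝ) : IsClosed (barycenterHypograph φ) := by
  have hmem : ∀ z ∈ barycenterHypograph φ, z.1 ∈ convexClosure A := by
    rintro z ⟨ν, hν, -⟩
    exact hν.mem_of_subset (subset_convexClosure A) (isClosed_convexClosure A)
      (convex_convexClosure A)
  have := h.metric.polishSpace
  let j : convexClosure A × ℝ → E × ℝ := Prod.map (↑) id
  have hj : IsClosedEmbedding j :=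
    (isClosed_convexClosure A).isClosedEmbedding_subtypeVal.prodMap .id
  have hrange : barycenterHypograph φ = j '' (j ⁻¹' barycenterHypograph φ) := by
    refine (image_preimage_eq_of_subset fun z hz => ?_).symm
    exact ⟨(⟨z.1, hmem z hz⟩, z.2), rfl⟩
  rw [hrange]
  refine hj.isClosedMap _ (IsSeqClosed.isClosed fun z z₀ hz hlim => ?_)
  choose ν hν hφ using hz
  have hlim₁ : Tendsto (fun n => ((z n).1 : E)) atTop (𝓝 (z₀.1 : E)) :=
    ((continuous_subtype_val.comp continuous_fst).tendsto z₀).comp hlim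
  have hlim₂ : Tendsto (fun n => (z n).2) atTop (𝓝 z₀.2) := (continuous_snd.tendsto z₀).comp hlim
  have hc := h.isCompact_barycenterPreimage (by
    rintro _ (rfl | ⟨n, rfl⟩)
    exacts [z₀.1.2, (z n).1.2]) hlim₁.isCompact_insert_range
  let U : Ultrafilter ℕ := hyperfilter ℕ
  have hU : (U : Filter ℕ) ≤ atTop := Nat.hyperfilter_le_atTop
  obtain ⟨ν₀, -, hν₀⟩ := hc.ultrafilter_le_nhds (U.map ν) (le_principal_iff.2 <|
    show ν ⁻¹' _ ∈ U from mem_of_superset univ_mem fun n _ => ⟨_, Or.inr ⟨n, rfl⟩, hν n⟩)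
  have hν₀ : Tendsto ν U (𝓝 ν₀) := hν₀
  exact ⟨ν₀, isBarycenter_of_tendsto h.bounded hν₀ (hlim₁.mono_left hU)
      (Eventually.of_forall hν),
    le_of_tendsto_of_tendsto' (hlim₂.mono_left hU)
      (ProbabilityMeasure.tendsto_iff_forall_integral_tendsto.1 hν₀ φ) hφ⟩

variable [IsTopologicalAddGroup E] [ContinuousSMul ℝ E] [LocallyConvexSpace ℝ E] [T2Space E]

/-- The set of barycenters is the slice at height zero of the hypograph for `φ = 0`. It is closed
and convex, and contains `A` through the Dirac measures. -/
theorem IsMuCompact.exists_isBarycenter (h : IsMuCompact A) {x : E} (hx : x ∈ convexClosure A) :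
    ∃ ν : ProbabilityMeasure A, IsBarycenter (ν : Measure A) x := by
  let H : Set E := (fun x => (x, (0 : ℝ))) ⁻¹' barycenterHypograph (A := A) 0
  have hcl : IsClosed H := (h.isClosed_barycenterHypograph 0).preimage (by fun_prop)
  have hconv : Convex ℝ H := fun x hx y hy a b ha hb hab => by
    have := convex_barycenterHypograph (A := A) 0 hx hy ha hb hab
    simpa [H] using this
  have hAH : A ⊆ H := fun a ha => by
    let ν : ProbabilityMeasure A := ⟨Measure.dirac ⟨a, ha⟩, inferInstance⟩
    refine ⟨ν, fun f => ⟨integrable_continuousLinearMap h.bounded ν f, ?_⟩, by simp⟩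
    exact integral_dirac' _ _ (f.continuous.comp continuous_subtype_val).stronglyMeasurable
  obtain ⟨ν, hν, -⟩ := convexClosure_subset hAH hcl hconv hx
  exact ⟨ν, hν⟩

/-- If `∫ φ dν ≤ s` for all `ν` with barycenter `x₀`, then for each `t > s` there is a continuous
affine function on `E` with value less than `t` at `x₀` which at every `x` is at least `∫ φ dν` for
all `ν` with barycenter `x`. -/
theorem IsMuCompact.exists_affine_majorant (h : IsMuCompact A) (φ : BoundedContinuousFunction A ℝ)
    {x₀ : E} (hx₀ : x₀ ∈ convexClosure A) {s t : ℝ} (hst : s < t)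
    (hs : ∀ ν : ProbabilityMeasure A, IsBarycenter (ν : Measure A) x₀ →
      ∫ a, φ a ∂(ν : Measure A) ≤ s) :
    ∃ (g : E →L[ℝ] ℝ) (c : ℝ), g x₀ + c < t ∧ ∀ (x : E) (ν : ProbabilityMeasure A),
      IsBarycenter (ν : Measure A) x → ∫ a, φ a ∂(ν : Measure A) ≤ g x + c := by
  have hnot : (x₀, t) ∉ barycenterHypograph φ := by
    rintro ⟨ν, hν, ht⟩
    exact absurd (ht.trans (hs ν hν)) (not_le.2 hst)
  obtain ⟨f, u, hf, hu⟩ := geometric_hahn_banach_closed_point (convex_barycenterHypograph φ)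
    (h.isClosed_barycenterHypograph φ) hnot
  let g : E →L[ℝ] ℝ := f.comp (ContinuousLinearMap.inl ℝ E ℝ)
  let d : ℝ := f (0, 1)
  have hfd (x : E) (τ : ℝ) : f (x, τ) = g x + d * τ := by
    have : (x, τ) = (x, (0 : ℝ)) + τ • ((0 : E), (1 : ℝ)) := by simp
    rw [this, map_add, map_smul, smul_eq_mul, mul_comm]
    rfl
  obtain ⟨ν₀, hν₀⟩ := h.exists_isBarycenter hx₀
  have h₀ := hf (x₀, ∫ a, φ a ∂(ν₀ : Measure A)) ⟨ν₀, hν₀, le_rfl⟩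
  rw [hfd] at h₀ hu
  have hlt : ∫ a, φ a ∂(ν₀ : Measure A) < t := (hs ν₀ hν₀).trans_lt hst
  -- The separating hyperplane is not vertical, because the hypograph has a point strictly below
  -- `(x₀, t)` on the same vertical line.
  have hd : 0 < d := by
    by_contra hd
    nlinarith
  refine ⟨-(d⁻¹ • g), u / d, ?_, fun x ν hν => ?_⟩
  · simp only [neg_apply, smul_apply, smul_eq_mul]
    rw [show -(d⁻¹ * g x₀) + u / d = (u - g x₀) / d by field_simp; ring, div_lt_iff₀ hd]
    linarith
  · have := hf (x, ∫ a, φ a ∂(ν : Measure A)) ⟨ν, hν, le_rfl⟩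
    rw [hfd] at this
    simp only [neg_apply, smul_apply, smul_eq_mul]
    rw [show -(d⁻¹ * g x) + u / d = (u - g x) / d by field_simp; ring, le_div_iff₀ hd]
    linarith

variable [MeasurableSpace (convexClosure A)]

/-- Markov's inequality is applied to an affine majorant, whose integral is its value at `x₀`; thus
no measurability of the envelope and no measurable choice of `ν` is needed. -/
theorem IsMuCompact.measure_integral_ge_le (h : IsMuCompact A)
    {φ : BoundedContinuousFunction A ℝ} (hφ : ∀ a, 0 ≤ φ a)
    (μ : Measure (convexClosure A)) [IsProbabilityMeasure μ] {x₀ : E} (hμ : IsBarycenter μ x₀)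
    {s t r : ℝ} (hst : s < t) (hr : 0 < r)
    (hs : ∀ ν : ProbabilityMeasure A, IsBarycenter (ν : Measure A) x₀ →
      ∫ a, φ a ∂(ν : Measure A) ≤ s) :
    μ {x | ∃ ν : ProbabilityMeasure A, IsBarycenter (ν : Measure A) (x : E) ∧
      r ≤ ∫ a, φ a ∂(ν : Measure A)} ≤ ENNReal.ofReal (t / r) := by
  have hx₀ : x₀ ∈ convexClosure A :=
    hμ.mem_of_subset Subset.rfl (isClosed_convexClosure A) (convex_convexClosure A)
  obtain ⟨g, c, hgt, hg⟩ := h.exists_affine_majorant φ hx₀ hst hs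
  have hi : Integrable (fun x : convexClosure A => g x + c) μ :=
    (hμ g).1.add (integrable_const c)
  have hint : ∫ x : convexClosure A, (g x + c) ∂μ = g x₀ + c := by
    rw [integral_add (hμ g).1 (integrable_const c), (hμ g).2]
    simp
  have hnn (x : convexClosure A) : 0 ≤ g x + c := by
    obtain ⟨ν, hν⟩ := h.exists_isBarycenter x.2
    exact (integral_nonneg hφ).trans (hg x ν hν)
  have hmarkov := mul_meas_ge_le_integral_of_nonneg (ae_of_all _ hnn) hi r
  rw [hint] at hmarkov
  refine (measure_mono (t := {x : convexClosure A | r ≤ g x + c}) ?_).trans ?_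
  · rintro x ⟨ν, hν, hrν⟩
    exact hrν.trans (hg x ν hν)
  · rw [← ENNReal.ofReal_toReal (measure_ne_top μ {x : convexClosure A | r ≤ g x + c})]
    refine ENNReal.ofReal_le_ofReal ((le_div_iff₀ hr).2 ?_)
    rw [mul_comm]
    exact hmarkov.trans hgt.le

/-- The indicator of the open set `Qᶜ` is the increasing limit of the continuous functions `1 -
thickenedIndicator`, to which the previous bound applies. -/
theorem IsMuCompact.measure_compl_gt_le (h : IsMuCompact A) {Q : Set A} (hQ : IsClosed Q)
    (μ : Measure (convexClosure A)) [IsProbabilityMeasure μ] {x₀ : E} (hμ : IsBarycenter μ x₀)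
    {s t r : ℝ} (hst : s < t) (hr : 0 < r)
    (hs : ∀ ν : ProbabilityMeasure A, IsBarycenter (ν : Measure A) x₀ →
      (ν : Measure A).real Qᶜ ≤ s) :
    μ {x | ∃ ν : ProbabilityMeasure A, IsBarycenter (ν : Measure A) (x : E) ∧
      r < (ν : Measure A).real Qᶜ} ≤ ENNReal.ofReal (t / r) := by
  have := h.polishSpace
  let := TopologicalSpace.upgradeIsCompletelyMetrizable A
  have hδ (n : ℕ) : (0 : ℝ) < 1 / ((n : ℝ) + 1) := Nat.one_div_pos_of_nat
  let φ (n : ℕ) : BoundedContinuousFunction A ℝ :=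
    BoundedContinuousFunction.ofNormedAddCommGroup
      (fun a => 1 - (thickenedIndicator (hδ n) Q a : ℝ)) (by fun_prop) 1 fun a => by
        have h₁ : (thickenedIndicator (hδ n) Q a : ℝ) ≤ 1 := thickenedIndicator_le_one (hδ n) Q a
        have h₀ : (0 : ℝ) ≤ thickenedIndicator (hδ n) Q a := NNReal.coe_nonneg _
        rw [Real.norm_eq_abs, abs_le]
        constructor <;> linarith
  have hφ (n : ℕ) (a : A) : φ n a = 1 - (thickenedIndicator (hδ n) Q a : ℝ) := rfl
  have hφ₀ (n : ℕ) (a : A) : 0 ≤ φ n a :=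
    sub_nonneg.2 (thickenedIndicator_le_one (hδ n) Q a)
  have hlim (ν : ProbabilityMeasure A) : Tendsto (fun n => ∫ a, φ n a ∂(ν : Measure A)) atTop
      (𝓝 ((ν : Measure A).real Qᶜ)) := by
    have := (tendsto_integral_thickenedIndicator_of_isClosed (ν : Measure A) hQ hδ
      tendsto_one_div_add_atTop_nhds_zero_nat).const_sub 1
    rw [← probReal_compl_eq_one_sub hQ.measurableSet] at this
    refine this.congr fun n => ?_
    simp only [hφ]
    rw [integral_sub (integrable_const _) (integrable_thickenedIndicator Q (hδ n))]
    simp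
  have hmono (ν : ProbabilityMeasure A) : Monotone fun n => ∫ a, φ n a ∂(ν : Measure A) := by
    intro m n hmn
    refine integral_mono ((φ m).integrable _) ((φ n).integrable _) fun a => ?_
    refine sub_le_sub_left (NNReal.coe_le_coe.2 ?_) 1
    exact thickenedIndicator_mono (hδ n) (hδ m) (Nat.one_div_le_one_div hmn) Q a
  let S (n : ℕ) : Set (convexClosure A) :=
    {x | ∃ ν : ProbabilityMeasure A, IsBarycenter (ν : Measure A) (x : E) ∧
      r ≤ ∫ a, φ n a ∂(ν : Measure A)}
  have hS : Monotone S := fun m n hmn x ⟨ν, hν, hr⟩ => ⟨ν, hν, hr.trans (hmono ν hmn)⟩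
  refine (measure_mono (t := ⋃ n, S n) ?_).trans ?_
  · rintro x ⟨ν, hν, hrν⟩
    obtain ⟨n, hn⟩ := ((hlim ν).eventually_const_lt hrν).exists
    exact mem_iUnion.2 ⟨n, ν, hν, hn.le⟩
  -- Continuity from below holds for any increasing sequence of sets, so the `S n` need not be
  -- measurable.
  · rw [hS.measure_iUnion]
    exact iSup_le fun n => h.measure_integral_ge_le (hφ₀ n) μ hμ hst hr fun ν hν =>
      ((hmono ν).ge_of_tendsto (hlim ν) n).trans (hs ν hν)

end Hypograph

/-! ### The convex closure of a μ-compact set -/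

/-- The barycenters of the measures which are almost concentrated on a fixed compact set have a
finite net for every continuous seminorm. -/
theorem exists_finite_net_barycenter {E : Type*} [AddCommGroup E] [Module ℝ E]
    [TopologicalSpace E] [IsTopologicalAddGroup E] [ContinuousSMul ℝ E]
    {A : Set E} [MeasurableSpace A] [BorelSpace A]
    [T2Space E] (hA : Bornology.IsVonNBounded ℝ A) {q : Seminorm ℝ E} (hq : Continuous q) {ε : ℝ}
    (hε : 0 < ε) :
    ∃ θ > 0, ∀ Q : Set A, IsCompact Q → ∃ F : Set E, F.Finite ∧
      ∀ (ν : ProbabilityMeasure A) (x : E), IsBarycenter (ν : Measure A) x →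
        (ν : Measure A).real Qᶜ ≤ θ → ∃ y ∈ F, q (x - y) < ε := by
  obtain ⟨M, hM, hMA⟩ := hA.exists_seminorm_le hq
  -- With this constant, the mass outside `Q` costs at most a quarter of the separation gap `s - f
  -- x` below; `θ` must not depend on `Q`.
  refine ⟨ε / (32 * M), by positivity, fun Q hQ => ?_⟩
  rcases isEmpty_or_nonempty A with hempty | ⟨⟨a₀⟩⟩
  · exact ⟨∅, finite_empty, fun ν => (hempty.false ν.nonempty.some).elim⟩
  have hnhds (y : E) {δ : ℝ} (hδ : 0 < δ) : {z | q (z - y) < δ} ∈ 𝓝 y := by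
    have : Continuous fun z => q (z - y) := by fun_prop
    exact this.continuousAt.eventually_lt_const (by simpa)
  obtain ⟨T, -, hT⟩ := hQ.elim_nhds_subcover (fun a : A => {b : A | q (b - a : E) < ε / 4})
    fun a _ => continuous_subtype_val.continuousAt (hnhds a (by positivity))
  -- The point `a₀` serves as the comparison point for the part of `A` outside `Q`.
  let D : Set E := convexHull ℝ ((↑) '' insert a₀ (T : Set A))
  have hD : IsCompact D := ((T.finite_toSet.insert a₀).image _).isCompact_convexHull ℝ
  have hTD (a : A) (ha : a ∈ insert a₀ (T : Set A)) : (a : E) ∈ D :=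
    subset_convexHull ℝ _ (mem_image_of_mem _ ha)
  obtain ⟨F, -, hF⟩ := hD.elim_nhds_subcover (fun y => {z | q (z - y) < ε / 2})
    fun y _ => hnhds y (half_pos hε)
  refine ⟨F, F.finite_toSet, fun ν x hx hν => ?_⟩
  suffices ∃ d ∈ D, q (d - x) < ε / 2 by
    obtain ⟨d, hd, hdx⟩ := this
    obtain ⟨y, hy, hdy⟩ := mem_iUnion₂.1 (hF hd)
    have hdy : q (d - y) < ε / 2 := hdy
    refine ⟨y, hy, ?_⟩
    calc q (x - y) = q ((d - y) - (d - x)) := by congr 1; abel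
      _ ≤ q (d - y) + q (d - x) := map_sub_le_add _ _ _
      _ < ε := by linarith
  by_contra! hfar
  have hball : {z | q (z - x) < ε / 2} = q.ball x (ε / 2) := rfl
  obtain ⟨f, s, hfx, hfD⟩ := geometric_hahn_banach_open (s := {z | q (z - x) < ε / 2}) (t := D)
    (by rw [hball]; exact q.convex_ball x _)
    (isOpen_lt (by fun_prop) continuous_const) (convex_convexHull ℝ _)
    (disjoint_left.2 fun z hz hzD => not_lt.2 (hfar z hzD) hz)
  have hσ : 0 < s - f x := by
    have := hfx x (by simpa using half_pos hε)
    linarith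
  -- Since `f < s` on the ball of radius `ε / 2` about `x`, scaling bounds `f` by `q` in units of
  -- the gap.
  have hlip (v : E) {κ : ℝ} (hκ : 0 < κ) (hv : q v < κ) : f v ≤ (s - f x) * (2 * κ / ε) := by
    have hmem : x + (ε / (2 * κ)) • v ∈ {z | q (z - x) < ε / 2} := by
      change q (x + (ε / (2 * κ)) • v - x) < ε / 2
      rw [add_sub_cancel_left, map_smul_eq_mul, Real.norm_of_nonneg (by positivity)]
      calc ε / (2 * κ) * q v < ε / (2 * κ) * κ := by gcongr
        _ = ε / 2 := by field_simp
    have := hfx _ hmem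
    rw [map_add, map_smul, smul_eq_mul] at this
    calc f v = (ε / (2 * κ) * f v) * (2 * κ / ε) := by field_simp
      _ ≤ _ := by gcongr; linarith
  -- Integrating this gives `f x ≥ s - (3 / 4) * (s - f x)`, which contradicts `f x < s`.
  have hlow (a : A) : s - (s - f x) / 2 - Qᶜ.indicator (fun _ => 8 * M * (s - f x) / ε) a ≤ f a := by
    by_cases ha : a ∈ Q
    · obtain ⟨b, hb, hab⟩ := mem_iUnion₂.1 (hT ha)
      have hab : q (a - b : E) < ε / 4 := hab
      have h₁ := hlip (b - a : E) (κ := ε / 4) (by positivity) (by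
        rwa [← map_neg_eq_map, neg_sub])
      have h₂ := hfD b (hTD b (Or.inr hb))
      rw [map_sub, show 2 * (ε / 4) / ε = 1 / 2 by field_simp; norm_num] at h₁
      rw [indicator_of_notMem (by simpa using ha)]
      linarith
    · have h₁ := hlip (a₀ - a : E) (κ := 4 * M) (by positivity)
        ((map_sub_le_add q _ _).trans_lt (by linarith [hMA a₀ a₀.2, hMA a a.2]))
      have h₂ := hfD a₀ (hTD a₀ (Or.inl rfl))
      rw [map_sub, show (s - f x) * (2 * (4 * M) / ε) = 8 * M * (s - f x) / ε by ring] at h₁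
      rw [indicator_of_mem (by simpa using ha)]
      linarith
  have hQm : MeasurableSet Qᶜ := hQ.measurableSet.compl
  have hind : Integrable (Qᶜ.indicator fun _ : A => 8 * M * (s - f x) / ε) (ν : Measure A) :=
    (integrable_const _).indicator hQm
  have hint := integral_mono ((integrable_const (s - (s - f x) / 2)).sub hind) (hx f).1 hlow
  rw [(hx f).2, integral_sub' (integrable_const _) hind, integral_indicator_const _ hQm] at hint
  simp only [integral_const, probReal_univ, smul_eq_mul, one_mul] at hint
  have : (ν : Measure A).real Qᶜ * (8 * M * (s - f x) / ε) ≤ (s - f x) / 4 :=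
    calc _ ≤ ε / (32 * M) * (8 * M * (s - f x) / ε) := by gcongr
      _ = (s - f x) / 4 := by field_simp; norm_num
  linarith

theorem isMuCompact_convexClosure {E : Type*} [AddCommGroup E] [Module ℝ E]
    [TopologicalSpace E] [IsTopologicalAddGroup E] [ContinuousSMul ℝ E] [LocallyConvexSpace ℝ E]
    [T2Space E] {A : Set E} (h : IsMuCompact A) : IsMuCompact (convexClosure A) := by
  refine .of_tight (isClosed_convexClosure A) h.bounded.convexClosure
    (by rw [convexClosure_convexClosure]; exact h.metric) ?_
  intro _ _ K hK hKc ε hε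
  rw [convexClosure_convexClosure] at hK
  let : MeasurableSpace A := borel A
  have : BorelSpace A := ⟨rfl⟩
  obtain ⟨δ, hδ, hδε⟩ := ENNReal.exists_pos_sum_of_countable hε.ne' ℕ
  let r (k : ℕ) : ℝ := 1 / ((k : ℝ) + 1)
  have hr (k : ℕ) : 0 < r k := Nat.one_div_pos_of_nat
  have hδr (k : ℕ) : 0 < δ k * r k := mul_pos (hδ k) (hr k)
  -- Half of `δ k * r k` leaves room for `s < t = δ k * r k`; the Markov bound `t / r k` is then
  -- exactly `δ k`.
  choose Q hQ hν using fun k => h.tight hK hKc (ENNReal.ofReal_pos.2 (half_pos (hδr k)))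
  let L : Set E := {x | ∃ ν : ProbabilityMeasure A, IsBarycenter (ν : Measure A) x ∧
    ∀ k, (ν : Measure A).real (Q k)ᶜ ≤ r k}
  have hL : ∃ K' : Set (convexClosure A), IsCompact K' ∧ Subtype.val ⁻¹' L ⊆ K' := by
    obtain ⟨-, p, hp, htop, hcomp⟩ := h.metric
    refine exists_isCompact_of_finite_nets hp htop hcomp fun n η hη => ?_
    obtain ⟨θ, hθ, hnet⟩ := exists_finite_net_barycenter h.bounded (hp n) hη
    obtain ⟨k, hk⟩ := exists_nat_one_div_lt hθ
    obtain ⟨F, hF, hFx⟩ := hnet (Q k) (hQ k)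
    refine ⟨F, hF, ?_⟩
    rintro x ⟨ν, hνx, hνQ⟩
    exact hFx ν x hνx ((hνQ k).trans hk.le)
  obtain ⟨K', hK', hLK'⟩ := hL
  refine ⟨K', hK', fun μ x hx hμ => ?_⟩
  let B (k : ℕ) : Set (convexClosure A) :=
    {y | ∃ ν : ProbabilityMeasure A, IsBarycenter (ν : Measure A) (y : E) ∧
      r k < (ν : Measure A).real (Q k)ᶜ}
  have hsub : K'ᶜ ⊆ ⋃ k, B k := by
    intro y hy
    -- Any representing measure of `y` will do: as `y ∉ L`, it violates one of the bounds and so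
    -- puts `y` in some `B k`.
    obtain ⟨ν, hνy⟩ := h.exists_isBarycenter y.2
    by_contra hB
    refine hy (hLK' ⟨ν, hνy, fun k => not_lt.1 fun hk => hB (mem_iUnion.2 ⟨k, ν, hνy, hk⟩)⟩)
  refine (measure_mono hsub).trans ((measure_iUnion_le _).trans
    ((ENNReal.tsum_le_tsum fun k => ?_).trans hδε.le))
  have := h.measure_compl_gt_le (hQ k).isClosed (μ : Measure (convexClosure A)) hμ
    (half_lt_self (hδr k)) (hr k) fun ν hνx =>
      ENNReal.toReal_le_of_le_ofReal (half_pos (hδr k)).le (hν k ν x hx hνx)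
  rwa [mul_div_cancel_right₀ _ (hr k).ne', ENNReal.ofReal_coe_nnreal] at this

theorem mainTheorem3 :
    -- a closed subset of a μ-compact set is μ-compact
    (∀ (E : Type*) [AddCommGroup E] [Module ℝ E] [TopologicalSpace E]
      [IsTopologicalAddGroup E] [ContinuousSMul ℝ E] [LocallyConvexSpace ℝ E] [T2Space E]
      (A B : Set E), IsMuCompact A → B ⊆ A → IsClosed B → IsMuCompact B) ∧
    -- the convex closure of a μ-compact set is μ-compact
    (∀ (E : Type*) [AddCommGroup E] [Module ℝ E] [TopologicalSpace E]
      [IsTopologicalAddGroup E] [ContinuousSMul ℝ E] [LocallyConvexSpace ℝ E] [T2Space E]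
      (A : Set E), IsMuCompact A → IsMuCompact (convexClosure A)) ∧
    -- a finite or countable product of μ-compact sets is μ-compact in the product topology
    (∀ (ι : Type*) [Countable ι] (E : ι → Type*) [∀ i, AddCommGroup (E i)]
      [∀ i, Module ℝ (E i)] [∀ i, TopologicalSpace (E i)] [∀ i, IsTopologicalAddGroup (E i)]
      [∀ i, ContinuousSMul ℝ (E i)] [∀ i, LocallyConvexSpace ℝ (E i)] [∀ i, T2Space (E i)]
      (A : ∀ i, Set (E i)), (∀ i, IsMuCompact (A i)) → IsMuCompact (Set.pi Set.univ A)) := by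
  refine ⟨?_, ?_, ?_⟩
  · intro E _ _ _ _ _ _ _ A B h hBA hB
    exact h.subset hBA hB
  · intro E _ _ _ _ _ _ _ A h
    exact isMuCompact_convexClosure h
  · intro ι _ E _ _ _ _ _ _ _ A h
    exact IsMuCompact.pi h
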